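/- Let $R$ be a Noetherian commutative local ring whose total ring of fractions $Q$ (the localization of $R$ at its non-zero-divisors) is semisimple. Let $M$ be a finitely generated $R$-module with a projective resolution $$0\to P_1\xrightarrow{\varphi}P_0\to M\to 0,$$ where $P_0,P_1$ are projective $R$-modules (finitely generated or not). Write $(-)^*=\operatorname{Hom}_R(-,R)$ and let $\varphi^*:P_0^*\to P_1^*$ be the dual of $\varphi$. Let $k\ge 1$ be an integer. Recall that $M$ is called $k$-torsion free if $\operatorname{Ext}^i_R(D(M),R)=0$ for $1\le i\le k$, where $D(M)=\operatorname{Coker}(f^*)$ for a presentation $F_1\xrightarrow{f}F_0\to M\to 0$ by finite free modules (for $i\ge 1$ these $\operatorname{Ext}$ modules do not depend on the presentation). Then $M$ is $k$-torsion free if and only if $\operatorname{depth}R_{\mathfrak p}\ge k+1$ for every prime $\mathfrak p\in\operatorname{Supp}(\operatorname{Coker}(\varphi^*))$. Moreover, if $R$ is Cohen–Macaulay, then $M$ is $k$-torsion free if and only if $\operatorname{codim}(R/\mathfrak p)\ge k+1$ for every prime $\mathfrak p\in\operatorname{Supp}(\operatorname{Coker}(\varphi^*))$, where $\operatorname{codim}(R/\mathfrak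 p)=\dim R-\dim(R/\mathfrak p)$. -/

import Mathlib

universe u v

noncomputable section

/-- The depth of a local ring `A`: the maximal length of an `A`-regular sequence contained in the
maximal ideal (as a supremum in `ℕ∞`; it is attained when `A` is Noetherian). -/
def localDepth (A : Type u) [CommRing A] [IsLocalRing A] : ℕ∞ :=
  ⨆ (rs : List A) (_ : RingTheory.Sequence.IsRegular A rs ∧
    ∀ r ∈ rs, r ∈ IsLocalRing.maximalIdeal A), (rs.length : ℕ∞)

/-- A Noetherian local ring is Cohen-Macaulay if its depth equals its Krull dimension. -/
def IsLocalCohenMacaulay (A : Type u) [CommRing A] [IsLocalRing A] : Prop :=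
  IsNoetherianRing A ∧ (localDepth A : WithBot ℕ∞) = ringKrullDim A

/-- `codim (A / I) = dim A - dim (A / I)`, for a proper ideal `I` of a ring of finite Krull
dimension (both dimensions are then natural numbers and the second is at most the first). -/
def quotientCodim {A : Type u} [CommRing A] (I : Ideal A) : ℕ∞ :=
  (ringKrullDim A).unbotD 0 - (ringKrullDim (A ⧸ I)).unbotD 0

/-- The cokernel of the dual `φ^* : Hom(P₀, R) → Hom(P₁, R)` of a linear map `φ : P₁ → P₀`. -/
abbrev CokerDual {R : Type*} [CommRing R] {P₁ P₀ : Type*} [AddCommGroup P₁] [Module R P₁]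
    [AddCommGroup P₀] [Module R P₀] (φ : P₁ →ₗ[R] P₀) : Type _ :=
  Module.Dual R P₁ ⧸ LinearMap.range φ.dualMap

/-- `M` is `k`-torsion free: for a presentation `R^m --f--> R^n --π--> M → 0` by finite free modules,
with `D(M) = Coker (f^*)`, the modules `Ext^i(D(M), R)` vanish for `1 ≤ i ≤ k`. The groups
`Ext^i(D(M), R)`, `i ≥ 1`, do not depend on the presentation, up to isomorphism. -/
def IsKTorsionFree (R : Type u) [CommRing R] (M : Type v) [AddCommGroup M] [Module R M]
    (k : ℕ) : Prop :=
  ∃ (m n : ℕ) (f : (Fin m → R) →ₗ[R] (Fin n → R)) (π : (Fin n → R) →ₗ[R] M),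
    Function.Exact f π ∧ Function.Surjective π ∧
    ∀ i : ℕ, 1 ≤ i → i ≤ k →
      Subsingleton (CategoryTheory.Abelian.Ext.{u}
        (ModuleCat.of R (CokerDual f)) (ModuleCat.of R R) i)

end

open CategoryTheory Abelian RingTheory.Sequence Pointwise TensorProduct

/-! Factor a finite presentation `f` of `M` as a surjection `g` onto its image `K`, followed by the
inclusion `ι` of `K` in the free module. Comparing resolutions shows that `K` is projective and that
`Coker ι^* ≅ Coker φ^*`, even if `P₀`, `P₁` are not finitely generated
(`projective_syzygy_of_exact`, `nonempty_cokerDual_equiv`). In `0 → Coker ι^* → Coker f^* → Coker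
g^* → 0` the last term is projective, so `D(M) = Coker f^*` and `C = Coker ι^*` have simultaneously
vanishing `Ext^i(-, R)` for `i ≥ 1`. Semisimplicity of `Q` gives `Hom(C, R) = 0`
(`subsingleton_dual_cokerDual`). Hence `k`-torsion freeness says `Ext^i(C, R) = 0` for all `i < k +
1`, which the grade criterion `forall_subsingleton_ext_iff_le_localDepth` turns into depth at least
`k + 1` on `Supp C`. In the Cohen–Macaulay case, depth and codimension bounds at `p` are both
matched with regular sequences inside `p`. -/

/-! ### Extending regular sequences inside an ideal -/

theorem smul_top_quotSMulTop_lt_top {R M : Type*} [CommRing R] [AddCommGroup M] [Module R M]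
    {I : Ideal R} {r : R} (hr : r ∈ I) (hI : I • (⊤ : Submodule R M) < ⊤) :
    I • (⊤ : Submodule R (QuotSMulTop r M)) < ⊤ := by
  refine lt_top_iff_ne_top.mpr fun eq => ?_
  absurd congrArg (Submodule.comap (Submodule.mkQ _)) eq
  simpa [Submodule.comap_smul_top_of_surjective I _ (Submodule.mkQ_surjective _),
    Submodule.smul_mono_left ((Ideal.span_singleton_le_iff_mem I).mpr hr),
    ← Submodule.ideal_span_singleton_smul] using hI.ne

/-- A regular sequence in `I` extends by `m` further elements of `I` as soon as enough `Ext`-modules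
from a module supported on `V(I)` vanish. -/
theorem exists_isRegular_append_of_subsingleton_ext {R : Type u} [CommRing R] [IsNoetherianRing R]
    (I : Ideal R) (N : ModuleCat.{u} R) [Module.Finite R N]
    (hN : Module.support R N = PrimeSpectrum.zeroLocus I) (m : ℕ) (rs : List R)
    (M : ModuleCat.{u} R) [Module.Finite R M] (hI : I • (⊤ : Submodule R M) < ⊤)
    (hrs : ∀ r ∈ rs, r ∈ I) (reg : IsRegular M rs)
    (hext : ∀ i < rs.length + m, Subsingleton (Ext N M i)) :
    ∃ ss : List R, ss.length = m ∧ (∀ r ∈ ss, r ∈ I) ∧ IsRegular M (rs ++ ss) := by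
  induction rs generalizing M with
  | nil =>
    simpa using ModuleCat.exists_isRegular_of_exists_subsingleton_ext I m M hI N hN
      (by simpa using hext)
  | cons x rs ih =>
    simp only [isRegular_cons_iff] at reg
    simp only [List.mem_cons, forall_eq_or_imp] at hrs
    simp only [List.length_cons] at hext
    have hext' : ∀ i < rs.length + m, Subsingleton (Ext N (ModuleCat.of R (QuotSMulTop x M)) i) := by
      intro i hi
      have zero1 := AddCommGrpCat.isZero_of_iff_subsingleton.mpr (hext i (by omega))
      have zero2 := AddCommGrpCat.isZero_of_iff_subsingleton.mpr (hext (i + 1) (by omega))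
      exact AddCommGrpCat.subsingleton_of_isZero <| ShortComplex.Exact.isZero_of_both_zeros
        ((Ext.covariant_sequence_exact₃' N reg.1.smulShortComplex_shortExact) i (i + 1) rfl)
        (zero1.eq_zero_of_src _) (zero2.eq_zero_of_tgt _)
    obtain ⟨ss, len, mem, h⟩ := ih (ModuleCat.of R (QuotSMulTop x M))
      (smul_top_quotSMulTop_lt_top hrs.1 hI) hrs.2 reg.2 hext'
    exact ⟨ss, len, mem, by simpa [isRegular_cons_iff] using ⟨reg.1, h⟩⟩

/-- The longer sequence `ss` forces `Ext^i(R/I, R) = 0` for `i < ss.length`, and this vanishing lets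
`rs` be extended to the same length. -/
theorem exists_isRegular_append_of_length_le {R : Type u} [CommRing R] [IsNoetherianRing R]
    (I : Ideal R) (hI : I ≠ ⊤) {rs ss : List R}
    (hrs : ∀ r ∈ rs, r ∈ I) (hr : IsRegular R rs)
    (hss : ∀ r ∈ ss, r ∈ I) (hs : IsRegular R ss) (hle : rs.length ≤ ss.length) :
    ∃ ts : List R, rs.length + ts.length = ss.length ∧ (∀ r ∈ ts, r ∈ I) ∧
      IsRegular R (rs ++ ts) := by
  have hI' : I • (⊤ : Submodule R (ModuleCat.of R R)) < ⊤ := by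
    simpa [lt_top_iff_ne_top] using hI
  have hN : Module.support R (R ⧸ I) = PrimeSpectrum.zeroLocus I := by
    rw [Module.support_eq_zeroLocus, Ideal.annihilator_quotient]
  obtain ⟨ts, h1, h2, h3⟩ := exists_isRegular_append_of_subsingleton_ext I (ModuleCat.of R (R ⧸ I))
    hN (ss.length - rs.length) rs (ModuleCat.of R R) hI' hrs hr (by
      rw [Nat.add_sub_cancel' hle]
      exact ModuleCat.subsingleton_ext_of_exists_isRegular I _ hN.le _ hI' ss hss hs)
  exact ⟨ts, by omega, h2, h3⟩

/-! ### Associated primes, regular sequences and dimension -/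

/-- An ideal consisting of zero-divisors on `M` is contained in an associated prime of `M`. -/
theorem exists_le_associatedPrimes_of_forall_not_isSMulRegular {R M : Type*} [CommRing R]
    [IsNoetherianRing R] [AddCommGroup M] [Module R M] [Module.Finite R M] (I : Ideal R)
    (h : ∀ r ∈ I, ¬ IsSMulRegular M r) : ∃ p ∈ associatedPrimes R M, I ≤ p := by
  refine (Ideal.subset_union_prime_finite (associatedPrimes.finite R M) I I
    fun p hp _ _ => IsAssociatedPrime.isPrime hp).mp ?_
  rw [biUnion_associatedPrimes_eq_compl_regular R M]
  exact fun r hr ↦ h r hr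

/-- Greedy construction: a sequence `rs` that cannot be prolonged inside `I` puts `I` inside an
associated prime of `R/(rs)`, by prime avoidance. -/
theorem exists_isRegular_of_forall_associatedPrimes {R : Type*} [CommRing R] [IsNoetherianRing R]
    (I : Ideal R) (hI : I ≠ ⊤) (n : ℕ)
    (h : ∀ rs : List R, (∀ r ∈ rs, r ∈ I) → IsRegular R rs → rs.length < n →
      ∀ p ∈ associatedPrimes R (R ⧸ (Ideal.ofList rs • (⊤ : Submodule R R))), ¬ I ≤ p) :
    ∃ rs : List R, rs.length = n ∧ (∀ r ∈ rs, r ∈ I) ∧ IsRegular R rs := by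
  suffices ∀ m ≤ n, ∃ rs : List R, rs.length = m ∧ (∀ r ∈ rs, r ∈ I) ∧ IsRegular R rs from
    this n le_rfl
  intro m hm
  induction m with
  | zero =>
    have : Nontrivial R := (Submodule.nontrivial_iff R).mp ⟨I, ⊤, hI⟩
    exact ⟨[], rfl, by simp, .nil R R⟩
  | succ m ih =>
    obtain ⟨rs, len, mem, reg⟩ := ih (by omega)
    obtain ⟨x, hx, hreg⟩ : ∃ x ∈ I,
        IsSMulRegular (R ⧸ (Ideal.ofList rs • (⊤ : Submodule R R))) x := by
      by_contra! hcon
      obtain ⟨p, hp, hle⟩ := exists_le_associatedPrimes_of_forall_not_isSMulRegular I hcon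
      exact h rs mem reg (by omega) p hp hle
    have hmem : ∀ r ∈ rs ++ [x], r ∈ I := by
      simp only [List.mem_append, List.mem_singleton]
      rintro r (hr | rfl)
      exacts [mem r hr, hx]
    refine ⟨rs ++ [x], by simp [len], hmem, ⟨?_, ?_⟩⟩
    · rw [isWeaklyRegular_append_iff, isWeaklyRegular_singleton_iff]
      exact ⟨reg.1, hreg⟩
    · intro htop
      have : Ideal.ofList (rs ++ [x]) ≤ I := Ideal.span_le.mpr hmem
      simp only [smul_eq_mul, Ideal.mul_top] at htop
      exact hI (top_le_iff.mp (htop.le.trans this))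

/-- If `x` is `M`-regular and `q` is associated to `M`, then some associated prime of `M / x M`
contains `q` and `x`. -/
theorem exists_associatedPrimes_quotSMulTop {R M : Type*} [CommRing R] [IsNoetherianRing R]
    [IsLocalRing R] [AddCommGroup M] [Module R M] [Module.Finite R M] {x : R}
    (hx : x ∈ IsLocalRing.maximalIdeal R) (reg : IsSMulRegular M x) {q : Ideal R}
    (hq : q ∈ associatedPrimes R M) :
    ∃ p ∈ associatedPrimes R (QuotSMulTop x M), q ≤ p ∧ x ∈ p := by
  obtain ⟨hqp, y, hy⟩ := isAssociatedPrime_iff.mp (AssociatedPrimes.mem_iff.mp hq)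
  let U : Submodule R M := ⨅ a ∈ q, LinearMap.ker (LinearMap.lsmul R M a)
  have hU : ∀ z, z ∈ U ↔ ∀ a ∈ q, a • z = 0 := by simp [U]
  have hyU : y ∈ U := (hU y).mpr fun a ha => by
    rw [hy, Submodule.mem_colon_singleton] at ha
    simpa using ha
  have hy0 : y ≠ 0 := by
    rintro rfl
    apply hqp.ne_top
    rw [hy, eq_top_iff]
    intro a _
    simp [Submodule.mem_colon_singleton]
  -- Nakayama: if `U`, the elements killed by `q`, lay in `xM`, regularity of `x` would give `U =
  -- xU`, hence `U = 0`.
  obtain ⟨z, hzU, hz⟩ : ∃ z ∈ U, z ∉ x • (⊤ : Submodule R M) := by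
    by_contra! hcon
    have hle : U ≤ IsLocalRing.maximalIdeal R • U := by
      intro z hz
      obtain ⟨w, -, rfl⟩ := Submodule.mem_smul_pointwise_iff_exists _ _ _ |>.mp (hcon z hz)
      refine Submodule.smul_mem_smul hx ((hU w).mpr fun a ha => ?_)
      refine reg.right_eq_zero_of_smul ?_
      rw [smul_comm]
      exact (hU _).mp hz a ha
    have := Submodule.eq_bot_of_le_smul_of_le_jacobson_bot _ U (IsNoetherian.noetherian U) hle
      (IsLocalRing.maximalIdeal_le_jacobson _)
    exact hy0 (by simpa [this] using hyU)
  obtain ⟨p, hp, hle⟩ := exists_le_isAssociatedPrime_of_isNoetherianRing R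
    (Submodule.Quotient.mk z : QuotSMulTop x M) (by simpa using hz)
  refine ⟨p, hp, fun a ha => hle ?_, hle ?_⟩
  · rw [Submodule.mem_colon_singleton, ← Submodule.Quotient.mk_smul, (hU z).mp hzU a ha]
    simp
  · rw [Submodule.mem_colon_singleton, ← Submodule.Quotient.mk_smul, Submodule.mem_bot,
      Submodule.Quotient.mk_eq_zero]
    exact Submodule.smul_mem_pointwise_smul _ _ _ trivial

theorem ringKrullDim_quotient_succ_le_of_lt {R : Type*} [CommRing R] {p q : Ideal R} [p.IsPrime]
    {x : R} (hle : p ≤ q) (hx : x ∈ q) (hxp : x ∉ p) :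
    ringKrullDim (R ⧸ q) + 1 ≤ ringKrullDim (R ⧸ p) := by
  refine ringKrullDim_succ_le_of_surjective (Ideal.Quotient.factor hle)
    (Ideal.Quotient.factor_surjective hle) (r := Ideal.Quotient.mk p x) ?_ ?_
  · rw [mem_nonZeroDivisors_iff_ne_zero]
    rwa [Ne, Ideal.Quotient.eq_zero_iff_mem]
  · simpa [Ideal.Quotient.eq_zero_iff_mem] using hx

/-- The length of an `M`-regular sequence is at most `dim R / q` for every associated prime `q`
of `M`. -/
theorem length_le_ringKrullDim_quotient_of_mem_associatedPrimes {R M : Type*} [CommRing R]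
    [IsNoetherianRing R] [IsLocalRing R] [AddCommGroup M] [Module R M] [Module.Finite R M]
    (rs : List R) (hrs : ∀ r ∈ rs, r ∈ IsLocalRing.maximalIdeal R) (reg : IsWeaklyRegular M rs)
    {q : Ideal R} (hq : q ∈ associatedPrimes R M) :
    (rs.length : WithBot ℕ∞) ≤ ringKrullDim (R ⧸ q) := by
  induction rs generalizing M q with
  | nil =>
    have := (AssociatedPrimes.mem_iff.mp hq).isPrime
    simpa using ringKrullDim_nonneg_of_nontrivial
  | cons x rs ih =>
    rw [isWeaklyRegular_cons_iff] at reg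
    simp only [List.mem_cons, forall_eq_or_imp] at hrs
    obtain ⟨p, hp, hle, hx⟩ := exists_associatedPrimes_quotSMulTop hrs.1 reg.1 hq
    have := (AssociatedPrimes.mem_iff.mp hq).isPrime
    have hxq : x ∉ q := fun hxq => by
      have : x ∈ ⋃ p ∈ associatedPrimes R M, (p : Set R) := Set.mem_biUnion hq hxq
      rw [biUnion_associatedPrimes_eq_compl_regular R M] at this
      exact this reg.1
    calc ((x :: rs).length : WithBot ℕ∞) = rs.length + 1 := by simp
      _ ≤ ringKrullDim (R ⧸ p) + 1 := by gcongr; exact ih hrs.2 reg.2 hp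
      _ ≤ _ := ringKrullDim_quotient_succ_le_of_lt hle hx hxq

/-! ### Depth of localizations and the grade criterion -/

theorem natCast_le_localDepth_iff {A : Type u} [CommRing A] [IsLocalRing A] {n : ℕ} :
    (n : ℕ∞) ≤ localDepth A ↔ ∃ rs : List A, rs.length = n ∧
      (∀ r ∈ rs, r ∈ IsLocalRing.maximalIdeal A) ∧ IsRegular A rs := by
  constructor
  · intro h
    obtain ⟨rs, hle, hrs, reg⟩ : ∃ rs : List A, n ≤ rs.length ∧
        (∀ r ∈ rs, r ∈ IsLocalRing.maximalIdeal A) ∧ IsRegular A rs := by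
      cases n with
      | zero => exact ⟨[], by simp, by simp, .nil A A⟩
      | succ n =>
        have h' : (n : ℕ∞) < localDepth A := lt_of_lt_of_le (by exact_mod_cast n.lt_succ_self) h
        simp only [localDepth, lt_iSup_iff] at h'
        obtain ⟨rs, ⟨reg, hrs⟩, hlt⟩ := h'
        exact ⟨rs, by exact_mod_cast hlt, hrs, reg⟩
    have hmem : ∀ r ∈ rs.take n, r ∈ IsLocalRing.maximalIdeal A :=
      fun r hr => hrs r (List.mem_of_mem_take hr)
    refine ⟨rs.take n, by simpa using hle, hmem, ?_⟩
    rw [IsLocalRing.isRegular_iff_isWeaklyRegular_of_subset_maximalIdeal hmem]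
    have := reg.1
    rw [← List.take_append_drop n rs, isWeaklyRegular_append_iff] at this
    exact this.1
  · rintro ⟨rs, rfl, hrs, reg⟩
    exact le_iSup₂_of_le rs ⟨reg, hrs⟩ le_rfl

theorem natCast_le_localDepth_localization {R : Type u} [CommRing R] {p : Ideal R} [p.IsPrime]
    {rs : List R} (hrs : ∀ r ∈ rs, r ∈ p) (reg : IsRegular R rs) :
    (rs.length : ℕ∞) ≤ localDepth (Localization.AtPrime p) := by
  refine natCast_le_localDepth_iff.mpr ⟨rs.map (algebraMap R _), by simp, ?_,
    reg.1.isRegular_of_isLocalization_of_mem _ p hrs⟩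
  intro r hr
  obtain ⟨s, hs, rfl⟩ := List.mem_map.mp hr
  exact (IsLocalization.AtPrime.to_map_mem_maximal_iff _ p s).mpr (hrs s hs)

/-- If `p` is associated to `R / (rs)` for a regular sequence `rs` in `p`, then the depth of `R_p`
is at most the length of `rs`. -/
theorem localDepth_localization_le_of_mem_associatedPrimes {R : Type u} [CommRing R]
    [IsNoetherianRing R] {p : Ideal R} [p.IsPrime] {rs : List R} (hrs : ∀ r ∈ rs, r ∈ p)
    (reg : IsRegular R rs)
    (hp : p ∈ associatedPrimes R (R ⧸ (Ideal.ofList rs • (⊤ : Submodule R R)))) :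
    localDepth (Localization.AtPrime p) ≤ rs.length := by
  by_contra! hlt
  let A := Localization.AtPrime p
  obtain ⟨ss, hlen, hss, hs⟩ := natCast_le_localDepth_iff (n := rs.length + 1).mp
    (by simpa using Order.add_one_le_of_lt hlt)
  have hmem : ∀ r ∈ rs.map (algebraMap R A), r ∈ IsLocalRing.maximalIdeal A := by
    intro r hr
    obtain ⟨s, hs, rfl⟩ := List.mem_map.mp hr
    exact (IsLocalization.AtPrime.to_map_mem_maximal_iff _ p s).mpr (hrs s hs)
  -- Excess depth prolongs the image of `rs` by some `y` in `pA`. If `p` is the annihilator of `x`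
  -- modulo `rs`, then `y` kills `x` in `A/(rs)`. Regularity of `y` makes `x` vanish there, so some
  -- `s ∉ p` kills `x` modulo `rs`, a contradiction.
  obtain ⟨ts, htl, hts, ht⟩ := exists_isRegular_append_of_length_le (IsLocalRing.maximalIdeal A)
    (Ideal.IsPrime.ne_top inferInstance) hmem (reg.1.isRegular_of_isLocalization_of_mem A p hrs)
    hss hs (by simp [hlen])
  obtain ⟨y, rfl⟩ : ∃ y, ts = [y] := List.length_eq_one_iff.mp (by simp at htl; omega)
  have hy := hts y (by simp)
  have hreg := ht.1
  rw [isWeaklyRegular_append_iff, isWeaklyRegular_singleton_iff] at hreg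
  obtain ⟨-, x, hx⟩ := isAssociatedPrime_iff.mp (AssociatedPrimes.mem_iff.mp hp)
  obtain ⟨x, rfl⟩ := Submodule.Quotient.mk_surjective _ x
  have hx' : ∀ a, a ∈ p ↔ a * x ∈ Ideal.ofList rs := fun a => by
    conv_lhs => rw [hx]
    rw [Submodule.mem_colon_singleton, ← Submodule.Quotient.mk_smul, Submodule.mem_bot,
      Submodule.Quotient.mk_eq_zero]
    simp
  have hmap : y * algebraMap R A x ∈ (Ideal.ofList rs).map (algebraMap R A) := by
    have hle : p * Ideal.span {x} ≤ Ideal.ofList rs := by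
      rw [Ideal.mul_le]
      intro a ha b hb
      obtain ⟨c, rfl⟩ := Ideal.mem_span_singleton'.mp hb
      rw [mul_left_comm]
      exact Ideal.mul_mem_left _ _ ((hx' a).mp ha)
    refine Ideal.map_mono hle ?_
    rw [Ideal.map_mul]
    refine Ideal.mul_mem_mul ?_ (Ideal.mem_map_of_mem _ (Ideal.mem_span_singleton_self x))
    rwa [Localization.AtPrime.map_eq_maximalIdeal]
  have hxm : algebraMap R A x ∈ (Ideal.ofList rs).map (algebraMap R A) := by
    have := mem_of_isSMulRegular_quotient_of_smul_mem (N := Ideal.ofList (rs.map (algebraMap R A)) •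
      (⊤ : Submodule A A)) hreg.2 (x := algebraMap R A x) (by simpa [Ideal.map_ofList] using hmap)
    simpa [Ideal.map_ofList] using this
  rw [IsLocalization.algebraMap_mem_map_algebraMap_iff p.primeCompl] at hxm
  obtain ⟨s, hs, hsx⟩ := hxm
  exact hs ((hx' s).mpr hsx)

theorem exists_isRegular_of_forall_le_localDepth {R : Type u} [CommRing R] [IsNoetherianRing R]
    (I : Ideal R) (hI : I ≠ ⊤) (n : ℕ)
    (h : ∀ (p : Ideal R) [p.IsPrime], I ≤ p → (n : ℕ∞) ≤ localDepth (Localization.AtPrime p)) :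
    ∃ rs : List R, rs.length = n ∧ (∀ r ∈ rs, r ∈ I) ∧ IsRegular R rs := by
  refine exists_isRegular_of_forall_associatedPrimes I hI n fun rs hrs reg hlt p hp hle => ?_
  have := (AssociatedPrimes.mem_iff.mp hp).isPrime
  have h1 := localDepth_localization_le_of_mem_associatedPrimes (fun r hr => hle (hrs r hr)) reg hp
  have := (h p hle).trans h1
  exact absurd hlt (by simpa using this)

/-- The grade criterion: `Ext^i(C, R)` vanishes for `i < n` iff `depth R_p ≥ n` on the support
of `C`. -/
theorem forall_subsingleton_ext_iff_le_localDepth {R : Type u} [CommRing R] [IsNoetherianRing R]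
    (C : Type u) [AddCommGroup C] [Module R C] [Module.Finite R C] (n : ℕ) :
    (∀ i < n, Subsingleton (Ext (ModuleCat.of R C) (ModuleCat.of R R) i)) ↔
      ∀ p ∈ Module.support R C, (n : ℕ∞) ≤ localDepth (Localization.AtPrime p.asIdeal) := by
  have hsupp := Module.support_eq_zeroLocus (R := R) (M := C)
  -- The zero module is separated because regular sequences in the annihilator require a proper
  -- ideal.
  by_cases htop : Module.annihilator R C = ⊤
  · have hC : Subsingleton C := Module.annihilator_eq_top_iff.mp htop
    have h0 : Limits.IsZero (ModuleCat.of R C) := ModuleCat.isZero_of_subsingleton _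
    refine iff_of_true (fun i _ => ?_) (by simp [hsupp, htop])
    refine subsingleton_of_forall_eq 0 fun a => ?_
    rw [← Ext.mk₀_id_comp a, h0.eq_of_src (𝟙 _) 0]
    simp
  have hI' : Module.annihilator R C • (⊤ : Submodule R (ModuleCat.of R R)) < ⊤ := by
    simpa [lt_top_iff_ne_top] using htop
  constructor
  · intro h p hp
    obtain ⟨rs, rfl, hrs, reg⟩ := ModuleCat.exists_isRegular_of_exists_subsingleton_ext _ n
      (ModuleCat.of R R) hI' (ModuleCat.of R C) hsupp h
    rw [hsupp] at hp
    exact natCast_le_localDepth_localization (fun r hr => hp (hrs r hr)) reg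
  · intro h
    obtain ⟨rs, rfl, hrs, reg⟩ := exists_isRegular_of_forall_le_localDepth _ htop n
      fun p hp hle => h ⟨p, hp⟩ (by rw [hsupp]; exact hle)
    exact ModuleCat.subsingleton_ext_of_exists_isRegular _ (ModuleCat.of R C) hsupp.le
      (ModuleCat.of R R) hI' rs hrs reg

/-! ### Depth versus codimension in the Cohen–Macaulay case -/

theorem height_add_ringKrullDim_quotient_le {R : Type*} [CommRing R] (p : Ideal R) [p.IsPrime] :
    (p.height : WithBot ℕ∞) + ringKrullDim (R ⧸ p) ≤ ringKrullDim R := by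
  have : Nonempty (PrimeSpectrum R) := ⟨⟨p, inferInstance⟩⟩
  have h1 : ringKrullDim (R ⧸ p) = Order.coheight (⟨p, inferInstance⟩ : PrimeSpectrum R) := by
    rw [ringKrullDim_quotient, Order.coheight_eq_krullDim_Ici]
    rfl
  rw [h1, ringKrullDim, Order.krullDim_eq_iSup_height_add_coheight_of_nonempty,
    show p.height = Order.height (⟨p, inferInstance⟩ : PrimeSpectrum R) from
      PrimeSpectrum.height_eq_orderHeight ⟨p, inferInstance⟩]
  exact_mod_cast le_iSup (fun a : PrimeSpectrum R => Order.height a + Order.coheight a)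
    ⟨p, inferInstance⟩

theorem exists_ringKrullDim_eq_natCast (R : Type*) [CommRing R] [FiniteRingKrullDim R] :
    ∃ d : ℕ, ringKrullDim R = d := by
  obtain ⟨d, hd⟩ := WithBot.ne_bot_iff_exists.mp (ringKrullDim_ne_bot (R := R))
  obtain ⟨n, rfl⟩ := ENat.ne_top_iff_exists (n := d) |>.mp fun h =>
    ringKrullDim_ne_top (R := R) (by rw [← hd, h]; rfl)
  exact ⟨n, hd.symm⟩

theorem natCast_le_quotientCodim_iff {R : Type*} [CommRing R] [IsNoetherianRing R] [IsLocalRing R]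
    (p : Ideal R) [p.IsPrime] (n : ℕ) :
    (n : ℕ∞) ≤ quotientCodim p ↔ (n : WithBot ℕ∞) + ringKrullDim (R ⧸ p) ≤ ringKrullDim R := by
  have : IsLocalRing (R ⧸ p) :=
    .of_surjective' (Ideal.Quotient.mk p) Ideal.Quotient.mk_surjective
  obtain ⟨d, hd⟩ := exists_ringKrullDim_eq_natCast R
  obtain ⟨e, he⟩ := exists_ringKrullDim_eq_natCast (R ⧸ p)
  have hle : e ≤ d := by
    have := ringKrullDim_quotient_le p
    rw [hd, he] at this
    exact_mod_cast this
  have h1 : quotientCodim p = ((d - e : ℕ) : ℕ∞) := by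
    rw [quotientCodim, hd, he]
    rfl
  rw [h1, hd, he]
  norm_cast
  omega

theorem le_localDepth_localization_iff_le_quotientCodim {R : Type u} [CommRing R]
    [IsLocalRing R] (hR : IsLocalCohenMacaulay R) (p : Ideal R) [p.IsPrime] (n : ℕ) :
    (n : ℕ∞) ≤ localDepth (Localization.AtPrime p) ↔ (n : ℕ∞) ≤ quotientCodim p := by
  have := hR.1
  have : IsNoetherianRing (Localization.AtPrime p) :=
    IsLocalization.isNoetherianRing p.primeCompl _ inferInstance
  rw [natCast_le_quotientCodim_iff]
  constructor
  · intro h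
    obtain ⟨rs, rfl, hrs, reg⟩ := natCast_le_localDepth_iff.mp h
    have h1 : (rs.length : WithBot ℕ∞) ≤ ringKrullDim (Localization.AtPrime p) := by
      rw [← ringKrullDim_add_length_eq_ringKrullDim_of_isRegular rs reg]
      refine le_add_of_nonneg_left ?_
      have : Nontrivial (Localization.AtPrime p ⧸ Ideal.ofList rs) := by
        refine Ideal.Quotient.nontrivial_iff.mpr fun h => ?_
        simpa [h] using reg.top_ne_smul
      exact ringKrullDim_nonneg_of_nontrivial
    rw [IsLocalization.AtPrime.ringKrullDim_eq_height p] at h1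
    exact (add_le_add_left h1 _).trans (height_add_ringKrullDim_quotient_le p)
  · intro h
    obtain ⟨d, hd⟩ := exists_ringKrullDim_eq_natCast R
    have hdepth : localDepth R = d := by
      have := hR.2
      rw [hd] at this
      exact_mod_cast this
    obtain ⟨ss, hlen, hss, hs⟩ := natCast_le_localDepth_iff.mp hdepth.ge
    have hple := IsLocalRing.le_maximalIdeal_of_isPrime p
    have hdim : ∀ rs : List R, (∀ r ∈ rs, r ∈ p) → IsRegular R rs → rs.length ≤ d :=
      fun rs hrs reg => by
        have := natCast_le_localDepth_iff.mpr ⟨rs, rfl, fun r hr => hple (hrs r hr), reg⟩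
        rw [hdepth] at this
        exact_mod_cast this
    -- If `rs` gets stuck at an associated prime `q ⊇ p`, complete it to length `d = dim R`. The
    -- added elements give `d - rs.length ≤ dim R/q ≤ dim R/p ≤ d - n`, against `rs.length < n`.
    obtain ⟨rs, rfl, hrs, reg⟩ := exists_isRegular_of_forall_associatedPrimes p
      (Ideal.IsPrime.ne_top inferInstance) n fun rs hrs reg hlt q hq hle => by
        obtain ⟨ts, htl, hts, ht⟩ := exists_isRegular_append_of_length_le
          (IsLocalRing.maximalIdeal R) (Ideal.IsPrime.ne_top inferInstance)
          (fun r hr => hple (hrs r hr)) reg hss hs (hlen ▸ hdim rs hrs reg)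
        have h1 := length_le_ringKrullDim_quotient_of_mem_associatedPrimes ts hts
          ((isWeaklyRegular_append_iff _ _ _).mp ht.1).2 hq
        have h2 : ringKrullDim (R ⧸ q) ≤ ringKrullDim (R ⧸ p) :=
          ringKrullDim_le_of_surjective (Ideal.Quotient.factor hle)
            (Ideal.Quotient.factor_surjective hle)
        have h3 := (add_le_add_right (h1.trans h2) (n : WithBot ℕ∞)).trans h
        rw [hd] at h3
        norm_cast at h3
        omega
    exact natCast_le_localDepth_localization hrs reg

/-! ### Comparison of resolutions of length one -/

section Comparison

variable {R M P₀ P₁ F K X : Type*} [CommRing R] [AddCommGroup M] [Module R M]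
  [AddCommGroup P₀] [Module R P₀] [AddCommGroup P₁] [Module R P₁] [AddCommGroup F] [Module R F]
  [AddCommGroup K] [Module R K] [AddCommGroup X] [Module R X]

theorem LinearMap.exists_comp_eq_of_exact {φ : P₁ →ₗ[R] P₀} {ε : P₀ →ₗ[R] M}
    (hφ : Function.Injective φ) (hex : Function.Exact φ ε) (g : X →ₗ[R] P₀) (hg : ε ∘ₗ g = 0) :
    ∃ h : X →ₗ[R] P₁, φ ∘ₗ h = g := by
  have hmem : ∀ x, g x ∈ LinearMap.range φ := fun x => (hex (g x)).mp (LinearMap.congr_fun hg x)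
  refine ⟨(LinearEquiv.ofInjective φ hφ).symm.toLinearMap ∘ₗ g.codRestrict _ hmem, ?_⟩
  ext x
  have := LinearEquiv.apply_symm_apply (LinearEquiv.ofInjective φ hφ) (g.codRestrict _ hmem x)
  exact congrArg Subtype.val this

/-- Two resolutions of length one of the same module are homotopy equivalent. -/
theorem exists_homotopyEquiv_of_exact [Module.Projective R P₀] [Module.Projective R F]
    {φ : P₁ →ₗ[R] P₀} {ε : P₀ →ₗ[R] M} (hφ : Function.Injective φ) (hex : Function.Exact φ ε)
    (hε : Function.Surjective ε) {ι : K →ₗ[R] F} {π : F →ₗ[R] M} (hι : Function.Injective ι)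
    (hιπ : Function.Exact ι π) (hπ : Function.Surjective π) :
    ∃ (α : F →ₗ[R] P₀) (β : P₀ →ₗ[R] F) (a : K →ₗ[R] P₁) (b : P₁ →ₗ[R] K) (s : P₀ →ₗ[R] P₁)
      (t : F →ₗ[R] K), φ ∘ₗ a = α ∘ₗ ι ∧ ι ∘ₗ b = β ∘ₗ φ ∧
        b ∘ₗ a + t ∘ₗ ι = LinearMap.id ∧ a ∘ₗ b + s ∘ₗ φ = LinearMap.id := by
  obtain ⟨α, hα⟩ := Module.projective_lifting_property ε π hε
  obtain ⟨β, hβ⟩ := Module.projective_lifting_property π ε hπ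
  have hε0 : ε ∘ₗ φ = 0 := hex.linearMap_comp_eq_zero
  have hπ0 : π ∘ₗ ι = 0 := hιπ.linearMap_comp_eq_zero
  obtain ⟨a, ha⟩ := LinearMap.exists_comp_eq_of_exact hφ hex (α ∘ₗ ι)
    (by rw [← LinearMap.comp_assoc, hα, hπ0])
  obtain ⟨b, hb⟩ := LinearMap.exists_comp_eq_of_exact hι hιπ (β ∘ₗ φ)
    (by rw [← LinearMap.comp_assoc, hβ, hε0])
  -- Both `α ∘ β` and the identity lift the identity of `M`, so their difference factors through
  -- `φ`. Cancelling the injections later yields the identities in degree one.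
  obtain ⟨s, hs⟩ := LinearMap.exists_comp_eq_of_exact hφ hex (LinearMap.id - α ∘ₗ β)
    (by rw [LinearMap.comp_sub, ← LinearMap.comp_assoc, hα, hβ, LinearMap.comp_id, sub_self])
  obtain ⟨t, ht⟩ := LinearMap.exists_comp_eq_of_exact hι hιπ (LinearMap.id - β ∘ₗ α)
    (by rw [LinearMap.comp_sub, ← LinearMap.comp_assoc, hβ, hα, LinearMap.comp_id, sub_self])
  refine ⟨α, β, a, b, s, t, ha, hb, ?_, ?_⟩
  · refine (LinearMap.cancel_left hι).mp ?_
    rw [LinearMap.comp_add, ← LinearMap.comp_assoc, ← LinearMap.comp_assoc, hb, ht,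
      LinearMap.comp_assoc, ha, LinearMap.sub_comp, LinearMap.comp_assoc]
    simp
  · refine (LinearMap.cancel_left hφ).mp ?_
    rw [LinearMap.comp_add, ← LinearMap.comp_assoc, ← LinearMap.comp_assoc, ha, hs,
      LinearMap.comp_assoc, hb, LinearMap.sub_comp, LinearMap.comp_assoc]
    simp

/-- The map on cokernels of duals induced by a commutative square. -/
def CokerDual.map {φ : P₁ →ₗ[R] P₀} {ι : K →ₗ[R] F} (a : K →ₗ[R] P₁) (α : F →ₗ[R] P₀)
    (h : φ ∘ₗ a = α ∘ₗ ι) : CokerDual φ →ₗ[R] CokerDual ι :=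
  Submodule.mapQ _ _ a.dualMap (by
    rintro _ ⟨u, rfl⟩
    refine ⟨u ∘ₗ α, ?_⟩
    ext x
    simpa using congrArg u (LinearMap.congr_fun h x).symm)

/-- The homotopy gives `v ∘ a ∘ b - v = -(v ∘ s) ∘ φ`, which lies in the range of `φ^*`. -/
theorem CokerDual.map_comp_map_eq_id {φ : P₁ →ₗ[R] P₀} {ι : K →ₗ[R] F} {a : K →ₗ[R] P₁}
    {α : F →ₗ[R] P₀} (ha : φ ∘ₗ a = α ∘ₗ ι) {b : P₁ →ₗ[R] K} {β : P₀ →ₗ[R] F}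
    (hb : ι ∘ₗ b = β ∘ₗ φ) {s : P₀ →ₗ[R] P₁} (hs : a ∘ₗ b + s ∘ₗ φ = LinearMap.id) :
    CokerDual.map b β hb ∘ₗ CokerDual.map a α ha = LinearMap.id := by
  refine Submodule.linearMap_qext _ (LinearMap.ext fun v => ?_)
  refine (Submodule.Quotient.eq _).mpr ⟨-(v ∘ₗ s), LinearMap.ext fun x => ?_⟩
  have := congrArg v (LinearMap.congr_fun hs x)
  simp only [LinearMap.add_apply, LinearMap.comp_apply, map_add, LinearMap.id_apply] at this
  simp [← this]

theorem nonempty_cokerDual_equiv [Module.Projective R P₀] [Module.Projective R F]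
    {φ : P₁ →ₗ[R] P₀} {ε : P₀ →ₗ[R] M} (hφ : Function.Injective φ) (hex : Function.Exact φ ε)
    (hε : Function.Surjective ε) {ι : K →ₗ[R] F} {π : F →ₗ[R] M} (hι : Function.Injective ι)
    (hιπ : Function.Exact ι π) (hπ : Function.Surjective π) :
    Nonempty (CokerDual φ ≃ₗ[R] CokerDual ι) := by
  obtain ⟨α, β, a, b, s, t, ha, hb, ht, hs⟩ := exists_homotopyEquiv_of_exact hφ hex hε hι hιπ hπ
  exact ⟨LinearEquiv.ofLinearMap (CokerDual.map a α ha) (CokerDual.map b β hb)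
    (CokerDual.map_comp_map_eq_id hb ha ht) (CokerDual.map_comp_map_eq_id ha hb hs)⟩

/-- The identity `b ∘ a + t ∘ ι = id` makes `K` a direct summand of `P₁ × F`. -/
theorem projective_syzygy_of_exact [Module.Projective R P₀] [Module.Projective R P₁]
    [Module.Projective R F]
    {φ : P₁ →ₗ[R] P₀} {ε : P₀ →ₗ[R] M} (hφ : Function.Injective φ) (hex : Function.Exact φ ε)
    (hε : Function.Surjective ε) {ι : K →ₗ[R] F} {π : F →ₗ[R] M} (hι : Function.Injective ι)
    (hιπ : Function.Exact ι π) (hπ : Function.Surjective π) : Module.Projective R K := by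
  obtain ⟨α, β, a, b, s, t, ha, hb, ht, hs⟩ := exists_homotopyEquiv_of_exact hφ hex hε hι hιπ hπ
  exact Module.Projective.of_split (a.prod ι) (b.coprod t)
    (by rw [LinearMap.coprod_comp_prod, ht])

end Comparison

/-! ### Vanishing of the dual of the cokernel -/

section Torsion

/-- If the total ring of fractions is semisimple, every functional on a submodule of a finite free
module extends to the whole module after multiplication by a non-zero-divisor. -/
theorem exists_nonZeroDivisors_smul_eq_comp {R : Type u} [CommRing R]
    (hQ : IsSemisimpleRing (FractionRing R)) {K : Type v} [AddCommGroup K] [Module R K] {n : ℕ}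
    {ι : K →ₗ[R] (Fin n → R)} (hι : Function.Injective ι) (v : K →ₗ[R] R) :
    ∃ s ∈ nonZeroDivisors R, ∃ u : (Fin n → R) →ₗ[R] R, s • v = u ∘ₗ ι := by
  let Q := FractionRing R
  have hιQ : Function.Injective (ι.baseChange Q) :=
    Module.Flat.lTensor_preserves_injective_linearMap ι hι
  -- Self-injectivity of `Q` extends the functional over `Q`; a common denominator of its values on
  -- the standard basis then brings the extension back to `R`.
  have hinj : Module.Injective Q Q := Module.injective_of_isSemisimpleRing Q Q
  obtain ⟨w, hw⟩ := Module.Injective.extension_property Q Q _ _ (ι.baseChange Q) hιQ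
    (LinearMap.liftBaseChange Q (Algebra.linearMap R Q ∘ₗ v))
  let w' : (Fin n → R) →ₗ[R] Q := w.restrictScalars R ∘ₗ TensorProduct.mk R Q (Fin n → R) 1
  have hw' : ∀ x, w' (ι x) = algebraMap R Q (v x) := fun x => by
    simpa [w'] using LinearMap.congr_fun hw (1 ⊗ₜ x)
  obtain ⟨s, hs⟩ := IsLocalization.exist_integer_multiples_of_finite (nonZeroDivisors R)
    fun i => w' (Pi.single i 1)
  choose c hc using hs
  refine ⟨s, s.2, (Pi.basisFun R (Fin n)).constr R c, LinearMap.ext fun x => ?_⟩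
  apply IsFractionRing.injective R Q
  have key : Algebra.linearMap R Q ∘ₗ (Pi.basisFun R (Fin n)).constr R c = (s : R) • w' := by
    refine (Pi.basisFun R (Fin n)).ext fun i => ?_
    rw [LinearMap.comp_apply, Module.Basis.constr_basis]
    simpa using hc i
  have := LinearMap.congr_fun key (ι x)
  simp only [LinearMap.comp_apply, LinearMap.smul_apply, hw', Algebra.linearMap_apply] at this
  rw [LinearMap.comp_apply, this, LinearMap.smul_apply, smul_eq_mul, map_mul, Algebra.smul_def]

/-- Every class in the cokernel is killed by a non-zero-divisor, which acts injectively on `R`. -/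
theorem subsingleton_dual_cokerDual {R : Type u} [CommRing R]
    (hQ : IsSemisimpleRing (FractionRing R)) {K : Type v} [AddCommGroup K] [Module R K] {n : ℕ}
    {ι : K →ₗ[R] (Fin n → R)} (hι : Function.Injective ι) :
    Subsingleton (CokerDual ι →ₗ[R] R) := by
  refine subsingleton_of_forall_eq 0 fun h => ?_
  refine Submodule.linearMap_qext _ (LinearMap.ext fun v => ?_)
  obtain ⟨s, hs, u, hu⟩ := exists_nonZeroDivisors_smul_eq_comp hQ hι v
  have h1 : s • h (Submodule.Quotient.mk v) = 0 := by
    rw [← map_smul, ← Submodule.Quotient.mk_smul,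
      (Submodule.Quotient.mk_eq_zero _).mpr (LinearMap.mem_range.mpr ⟨u, hu.symm⟩), map_zero]
  exact (mul_right_mem_nonZeroDivisors_eq_zero_iff hs).mp (by simpa [mul_comm] using h1)

end Torsion

/-! ### Independence of the transpose from the presentation -/

section Transpose

variable {R : Type u} [CommRing R]

/-- A section `s` of `g` makes the cokernel a summand of the dual of `F`, embedded by `v ↦ v - v ∘ s
∘ g`. -/
theorem projective_cokerDual_of_surjective {F K : Type*} [AddCommGroup F]
    [Module R F] [Module.Free R F] [Module.Finite R F] [AddCommGroup K] [Module R K]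
    [Module.Projective R K] {g : F →ₗ[R] K} (hg : Function.Surjective g) :
    Module.Projective R (CokerDual g) := by
  obtain ⟨s, hs⟩ := Module.projective_lifting_property g LinearMap.id hg
  let j : CokerDual g →ₗ[R] Module.Dual R F :=
    Submodule.liftQ _ (LinearMap.id - (s ∘ₗ g).dualMap) (by
      rintro _ ⟨u, rfl⟩
      ext x
      simp only [LinearMap.sub_apply, LinearMap.id_apply, LinearMap.dualMap_apply,
        LinearMap.comp_apply, LinearMap.zero_apply]
      rw [show g (s (g x)) = g x from LinearMap.congr_fun hs (g x), sub_self])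
  refine Module.Projective.of_split j (Submodule.mkQ _) ?_
  refine Submodule.linearMap_qext _ (LinearMap.ext fun v => ?_)
  refine (Submodule.Quotient.eq _).mpr ⟨-(v ∘ₗ s), LinearMap.ext fun x => ?_⟩
  have hj : j (Submodule.Quotient.mk v) = v - v ∘ₗ s ∘ₗ g := rfl
  simp [hj]

/-- The transposes of two presentations `f = ι ∘ g` and `ι` differ by a projective summand, and
hence have the same higher `Ext`-modules. -/
theorem subsingleton_ext_cokerDual_comp_iff {F K : Type u} {G : Type u} [AddCommGroup F]
    [Module R F] [Module.Free R F] [Module.Finite R F] [AddCommGroup K] [Module R K]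
    [Module.Projective R K] [AddCommGroup G] [Module R G]
    {g : F →ₗ[R] K} (hg : Function.Surjective g) (ι : K →ₗ[R] G) (Y : ModuleCat.{u} R) {i : ℕ}
    (hi : 1 ≤ i) :
    Subsingleton (Ext (ModuleCat.of R (CokerDual (ι ∘ₗ g))) Y i) ↔
      Subsingleton (Ext (ModuleCat.of R (CokerDual ι)) Y i) := by
  let a : CokerDual ι →ₗ[R] CokerDual (ι ∘ₗ g) := CokerDual.map g LinearMap.id rfl
  let b : CokerDual (ι ∘ₗ g) →ₗ[R] CokerDual g := CokerDual.map LinearMap.id ι rfl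
  have ha : Function.Injective a := by
    refine (injective_iff_map_eq_zero a).mpr fun v => ?_
    obtain ⟨v, rfl⟩ := Submodule.Quotient.mk_surjective _ v
    intro hv
    obtain ⟨u, hu⟩ := (Submodule.Quotient.mk_eq_zero _).mp hv
    exact (Submodule.Quotient.mk_eq_zero _).mpr ⟨u, (LinearMap.cancel_right hg).mp hu⟩
  have hb : Function.Surjective b := by
    intro v
    obtain ⟨v, rfl⟩ := Submodule.Quotient.mk_surjective _ v
    exact ⟨Submodule.Quotient.mk v, rfl⟩
  have hab : Function.Exact a b := by
    intro v
    obtain ⟨v, rfl⟩ := Submodule.Quotient.mk_surjective _ v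
    constructor
    · intro hv
      obtain ⟨u, hu⟩ := (Submodule.Quotient.mk_eq_zero _).mp hv
      exact ⟨Submodule.Quotient.mk u, congrArg Submodule.Quotient.mk hu⟩
    · rintro ⟨u, hu⟩
      obtain ⟨u, rfl⟩ := Submodule.Quotient.mk_surjective _ u
      rw [← hu]
      exact (Submodule.Quotient.mk_eq_zero _).mpr ⟨u, rfl⟩
  let S : ShortComplex (ModuleCat.{u} R) := ShortComplex.mk (ModuleCat.ofHom a) (ModuleCat.ofHom b)
    (ModuleCat.hom_ext hab.linearMap_comp_eq_zero)
  have hS : S.ShortExact :=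
    { exact := (ShortComplex.ShortExact.moduleCat_exact_iff_function_exact S).mpr hab
      mono_f := (ModuleCat.mono_iff_injective _).mpr ha
      epi_g := (ModuleCat.epi_iff_surjective _).mpr hb }
  have : Module.Projective R (CokerDual g) := projective_cokerDual_of_surjective hg
  have hproj : Projective S.X₃ := (IsProjective.iff_projective (CokerDual g)).mp this
  -- In the long exact sequence both neighbouring terms, `Ext^{j+1}` and `Ext^{j+2}` out of the
  -- projective `X₃`, now have positive degree and vanish.
  obtain ⟨i, rfl⟩ : ∃ j, i = j + 1 := ⟨i - 1, by omega⟩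
  constructor
  · intro h
    refine subsingleton_of_forall_eq 0 fun x => ?_
    obtain ⟨y, rfl⟩ := Ext.contravariant_sequence_exact₁ hS Y x (add_comm 1 _)
      (Ext.eq_zero_of_projective _)
    have : y = 0 := h.elim _ _
    rw [this, Ext.comp_zero]
  · intro h
    refine subsingleton_of_forall_eq 0 fun x => ?_
    obtain ⟨y, rfl⟩ := Ext.contravariant_sequence_exact₂ hS Y x (h.elim _ _)
    rw [Ext.eq_zero_of_projective y, Ext.comp_zero]

end Transpose

/-! ### Torsion freeness in terms of depth and codimension -/

/-- For a presentation of a module with a projective resolution of length one, vanishing of the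
`Ext`-modules of the transpose is detected by the depth on the support of `Coker φ^*`. -/
theorem forall_subsingleton_ext_cokerDual_iff {R : Type u} [CommRing R] [IsNoetherianRing R]
    (hQ : IsSemisimpleRing (FractionRing R)) {M P₁ P₀ : Type*} [AddCommGroup M] [Module R M]
    [AddCommGroup P₁] [Module R P₁] [Module.Projective R P₁]
    [AddCommGroup P₀] [Module R P₀] [Module.Projective R P₀]
    {φ : P₁ →ₗ[R] P₀} {ε : P₀ →ₗ[R] M}
    (hφ : Function.Injective φ) (hex : Function.Exact φ ε) (hε : Function.Surjective ε) (k : ℕ)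
    {m n : ℕ} {f : (Fin m → R) →ₗ[R] (Fin n → R)} {π : (Fin n → R) →ₗ[R] M}
    (hf : Function.Exact f π) (hπ : Function.Surjective π) :
    (∀ i : ℕ, 1 ≤ i → i ≤ k →
      Subsingleton (Ext (ModuleCat.of R (CokerDual f)) (ModuleCat.of R R) i)) ↔
      ∀ p ∈ Module.support R (CokerDual φ),
        (k + 1 : ℕ∞) ≤ localDepth (Localization.AtPrime p.asIdeal) := by
  let ι : LinearMap.range f →ₗ[R] (Fin n → R) := (LinearMap.range f).subtype
  let g : (Fin m → R) →ₗ[R] LinearMap.range f := f.rangeRestrict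
  have hg : Function.Surjective g := f.surjective_rangeRestrict
  have hι : Function.Injective ι := Subtype.val_injective
  have hιπ : Function.Exact ι π := fun x => (hf x).trans (by simp [ι])
  obtain ⟨e⟩ := nonempty_cokerDual_equiv hφ hex hε hι hιπ hπ
  have hK : Module.Projective R (LinearMap.range f) :=
    projective_syzygy_of_exact hφ hex hε hι hιπ hπ
  -- Degree zero is not covered by torsion freeness; supplying it turns the `k` conditions into `k +
  -- 1` consecutive ones, hence the bound `k + 1`.
  have hzero : Subsingleton (Ext (ModuleCat.of R (CokerDual ι)) (ModuleCat.of R R) 0) := by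
    have := subsingleton_dual_cokerDual hQ hι
    exact (Ext.addEquiv₀.trans ModuleCat.homAddEquiv).subsingleton
  have key := forall_subsingleton_ext_iff_le_localDepth (R := R) (CokerDual ι) (k + 1)
  rw [e.support_eq]
  push_cast at key
  have hT {i : ℕ} (hi : 1 ≤ i) :
      Subsingleton (Ext (ModuleCat.of R (CokerDual f)) (ModuleCat.of R R) i) ↔
        Subsingleton (Ext (ModuleCat.of R (CokerDual ι)) (ModuleCat.of R R) i) :=
    subsingleton_ext_cokerDual_comp_iff hg ι _ hi
  rw [← key]
  constructor
  · intro h i hi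
    rcases Nat.eq_zero_or_pos i with rfl | hpos
    · exact hzero
    · exact (hT hpos).mp (h i hpos (by omega))
  · exact fun h i hpos hi => (hT hpos).mpr (h i (by omega))

/-- The depth condition does not see the presentation, so the existential choice in `IsKTorsionFree`
is harmless; finiteness of `M` over a Noetherian ring provides a presentation. -/
theorem isKTorsionFree_iff_le_localDepth {R : Type u} [CommRing R] [IsNoetherianRing R]
    (hQ : IsSemisimpleRing (FractionRing R)) {M P₁ P₀ : Type*} [AddCommGroup M] [Module R M]
    [Module.Finite R M] [AddCommGroup P₁] [Module R P₁] [Module.Projective R P₁]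
    [AddCommGroup P₀] [Module R P₀] [Module.Projective R P₀]
    {φ : P₁ →ₗ[R] P₀} {ε : P₀ →ₗ[R] M}
    (hφ : Function.Injective φ) (hex : Function.Exact φ ε) (hε : Function.Surjective ε) (k : ℕ) :
    IsKTorsionFree R M k ↔ ∀ p ∈ Module.support R (CokerDual φ),
      (k + 1 : ℕ∞) ≤ localDepth (Localization.AtPrime p.asIdeal) := by
  constructor
  · rintro ⟨m, n, f, π, hf, hπ, h⟩
    exact (forall_subsingleton_ext_cokerDual_iff hQ hφ hex hε k hf hπ).mp h
  · intro h
    obtain ⟨n, π, hπ⟩ := Module.Finite.exists_fin' R M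
    obtain ⟨m, f, hf⟩ := Module.Finite.exists_fin' R (LinearMap.ker π)
    have hex' : Function.Exact ((LinearMap.ker π).subtype ∘ₗ f) π := by
      rw [LinearMap.exact_iff, LinearMap.range_comp, LinearMap.range_eq_top.mpr hf,
        Submodule.map_top, Submodule.range_subtype]
    exact ⟨m, n, _, π, hex', hπ,
      (forall_subsingleton_ext_cokerDual_iff hQ hφ hex hε k hex' hπ).mpr h⟩

theorem theorem3p2 {R : Type*} [CommRing R] [IsNoetherianRing R] [IsLocalRing R]
    (hQ : IsSemisimpleRing (FractionRing R))
    {M P₁ P₀ : Type*} [AddCommGroup M] [Module R M] [Module.Finite R M]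
    [AddCommGroup P₁] [Module R P₁] [Module.Projective R P₁]
    [AddCommGroup P₀] [Module R P₀] [Module.Projective R P₀]
    (φ : P₁ →ₗ[R] P₀) (ε : P₀ →ₗ[R] M)
    (hφ : Function.Injective φ) (hex : Function.Exact φ ε) (hε : Function.Surjective ε)
    (k : ℕ) (hk : 1 ≤ k) :
    (IsKTorsionFree R M k ↔
      ∀ p ∈ Module.support R (CokerDual φ),
        (k + 1 : ℕ∞) ≤ localDepth (Localization.AtPrime p.asIdeal)) ∧
    (IsLocalCohenMacaulay R →
      (IsKTorsionFree R M k ↔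
        ∀ p ∈ Module.support R (CokerDual φ), (k + 1 : ℕ∞) ≤ quotientCodim p.asIdeal)) := by
  have h := isKTorsionFree_iff_le_localDepth hQ hφ hex hε k
  refine ⟨h, fun hCM => h.trans (forall₂_congr fun p _ => ?_)⟩
  exact_mod_cast le_localDepth_localization_iff_le_quotientCodim hCM p.asIdeal (k + 1)
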